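/- Let $d\ge 1$, let $\Omega\subset\mathbb{R}^d$ be a bounded domain (nonempty, open, connected), and let $\mu$ be a finite positive Borel measure on $\mathbb{R}^d$ with $\operatorname{supp}(\mu)\subset\overline{\Omega}$ and $\mu(\Omega)>0$. Assume the Poincaré inequality for $\mu$ (MPI): there is a constant $C>0$ such that $$\int_\Omega |\varphi|^2\,d\mu\le C\int_\Omega|\nabla\varphi|^2\,dx\qquad\text{for all }\varphi\in C_c^\infty(\Omega).$$ Let $H_0^1(\Omega)$ be the completion of $C_c^\infty(\Omega)$ for the inner product $\int_\Omega uv\,dx+\int_\Omega\nabla u\cdot\nabla v\,dx$, and let $\mathcal I:H_0^1(\Omega)\to L^2(\Omega,\mu)$ be the continuous extension of the inclusion $C_c^\infty(\Omega)\to L^2(\Omega,\mu)$, which exists by (MPI). Put $\mathcal E(u,v)=\int_\Omega\nabla u\cdot\nabla v\,dx$, $\mathcal N=\{u\in H_0^1(\Omega):\mathcal I(u)=0\}$ and $$\operatorname{Dom}(\mathcal E)=\mathcal N^\perp=\{u\in H_0^1(\Omega):\mathcal E(u,\tau)=0\text{ for all }\tau\in\mathcal N\}.$$ Let $-\Delta_\mu$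 be the nonnegative self-adjoint operator in $L^2(\Omega,\mu)$ associated with the closed form $(\mathcal E,\operatorname{Dom}(\mathcal E))$: $u\in\operatorname{Dom}(\Delta_\mu)$ and $\Delta_\mu u=g\in L^2(\Omega,\mu)$ if and only if $u\in\operatorname{Dom}(\mathcal E)$ and $\mathcal E(u,v)=-\int_\Omega g\,\mathcal I(v)\,d\mu$ for all $v\in\operatorname{Dom}(\mathcal E)$. Let $u:\Omega\to\mathbb{R}$ be continuous and nonconstant, with $u\in\operatorname{Dom}(\Delta_\mu)$ (that is, $u$ agrees Lebesgue-almost everywhere in $\Omega$ with an element of $\operatorname{Dom}(\Delta_\mu)\subset H_0^1(\Omega)$). (i) If $u$ is $\mu$-subharmonic, i.e. $\Delta_\mu u\ge 0$ $\mu$-a.e. in $\Omega$, then $u$ does not attain a maximum in $\Omega$: there is no $x_0\in\Omega$ with $u(x)\le u(x_0)$ for all $x\in\Omega$. (ii) If $u$ is $\mu$-superharmonic, i.e. $\Delta_\mu u\le 0$ $\mu$-a.e. in $\Omega$, then $u$ does not attain a minimum in $\Omega$: there is no $x_0\in\Omega$ with $u(x_0)\le u(x)$ for all $x\in\Omega$.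 -/

import Mathlib

open MeasureTheory Filter Topology TopologicalSpace
open scoped Distributions Gradient InnerProductSpace

namespace KreinFeller

noncomputable section

/-- The space `ℝ^d` with its Euclidean norm. -/
abbrev Space (d : ℕ) : Type := EuclideanSpace ℝ (Fin d)

/-- The space `L²(Ω, μ)` of real-valued functions. -/
abbrev L2 {d : ℕ} (Ω : Opens (Space d)) (μ : Measure (Space d)) : Type :=
  Lp ℝ 2 (μ.restrict (Ω : Set (Space d)))

/-- The space `L²(Ω; ℝ^d)` of vector fields, for Lebesgue measure. -/
abbrev L2Field {d : ℕ} (Ω : Opens (Space d)) : Type :=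
  Lp (Space d) 2 ((volume : Measure (Space d)).restrict (Ω : Set (Space d)))

/-- The Hilbert space `L²(Ω) × L²(Ω; ℝ^d)`; a pair `(u, ∇u)` has the norm
`(∫_Ω u² + ∫_Ω |∇u|²)^(1/2)` in it, which is the norm of `H¹(Ω)`. -/
abbrev L2Pair {d : ℕ} (Ω : Opens (Space d)) : Type :=
  WithLp 2 (L2 Ω volume × L2Field Ω)

theorem memLp_test {d : ℕ} {Ω : Opens (Space d)} (μ : Measure (Space d))
    [IsFiniteMeasureOnCompacts μ] (φ : 𝓓(Ω, ℝ)) :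
    MemLp φ 2 (μ.restrict (Ω : Set (Space d))) :=
  (φ.continuous.memLp_of_hasCompactSupport φ.hasCompactSupport).restrict _

theorem differentiable_test {d : ℕ} {Ω : Opens (Space d)} (φ : 𝓓(Ω, ℝ)) :
    Differentiable ℝ φ :=
  φ.contDiff.differentiable (by simp)

theorem memLp_grad_test {d : ℕ} {Ω : Opens (Space d)} (φ : 𝓓(Ω, ℝ)) :
    MemLp (∇ (φ : Space d → ℝ)) 2
      ((volume : Measure (Space d)).restrict (Ω : Set (Space d))) := by
  have hc : Continuous (∇ (φ : Space d → ℝ)) :=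
    (InnerProductSpace.toDual ℝ (Space d)).symm.continuous.comp
      (φ.contDiff.continuous_fderiv (by simp))
  have hs : HasCompactSupport (∇ (φ : Space d → ℝ)) :=
    (φ.hasCompactSupport.fderiv (𝕜 := ℝ)).comp_left
      (g := (InnerProductSpace.toDual ℝ (Space d)).symm) (map_zero _)
  exact (hc.memLp_of_hasCompactSupport hs).restrict _

theorem grad_add_test {d : ℕ} {Ω : Opens (Space d)} (φ ψ : 𝓓(Ω, ℝ)) :
    ∇ ((φ + ψ : 𝓓(Ω, ℝ)) : Space d → ℝ)
      = ∇ (φ : Space d → ℝ) + ∇ (ψ : Space d → ℝ) := by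
  ext1 x
  have h : fderiv ℝ ((φ + ψ : 𝓓(Ω, ℝ)) : Space d → ℝ) x
      = fderiv ℝ (φ : Space d → ℝ) x + fderiv ℝ (ψ : Space d → ℝ) x := by
    rw [FunLike.coe_add]
    exact fderiv_add (differentiable_test φ x) (differentiable_test ψ x)
  simp only [gradient, Pi.add_apply, h, map_add]

theorem grad_smul_test {d : ℕ} {Ω : Opens (Space d)} (c : ℝ) (φ : 𝓓(Ω, ℝ)) :
    ∇ ((c • φ : 𝓓(Ω, ℝ)) : Space d → ℝ) = c • ∇ (φ : Space d → ℝ) := by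
  ext1 x
  have h : fderiv ℝ ((c • φ : 𝓓(Ω, ℝ)) : Space d → ℝ) x
      = c • fderiv ℝ (φ : Space d → ℝ) x := by
    rw [FunLike.coe_smul]
    exact fderiv_const_smul (differentiable_test φ x) c
  simp only [gradient, Pi.smul_apply, h, map_smul]

/-- The class in `L²(Ω, μ)` of a function in `C_c^∞(Ω)`. -/
def testToL2 {d : ℕ} (Ω : Opens (Space d)) (μ : Measure (Space d))
    [IsFiniteMeasureOnCompacts μ] : 𝓓(Ω, ℝ) →ₗ[ℝ] L2 Ω μ where
  toFun φ := (memLp_test μ φ).toLp φ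
  map_add' _ _ := rfl
  map_smul' _ _ := rfl

/-- The gradient of a function in `C_c^∞(Ω)`, as an element of `L²(Ω; ℝ^d)`. -/
def testGrad {d : ℕ} (Ω : Opens (Space d)) : 𝓓(Ω, ℝ) →ₗ[ℝ] L2Field Ω where
  toFun φ := (memLp_grad_test φ).toLp (∇ (φ : Space d → ℝ))
  map_add' φ ψ := by
    rw [← MemLp.toLp_add]
    exact MemLp.toLp_congr _ _ (by rw [grad_add_test])
  map_smul' c φ := by
    rw [RingHom.id_apply, ← MemLp.toLp_const_smul]
    exact MemLp.toLp_congr _ _ (by rw [grad_smul_test])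

/-- The map `φ ↦ (φ, ∇φ)` on `C_c^∞(Ω)`, an isometry for the `H¹(Ω)` norm. -/
def testToPair {d : ℕ} (Ω : Opens (Space d)) : 𝓓(Ω, ℝ) →ₗ[ℝ] L2Pair Ω :=
  (WithLp.linearEquiv 2 ℝ (L2 Ω volume × L2Field Ω)).symm.toLinearMap ∘ₗ
    (testToL2 Ω volume).prod (testGrad Ω)

/-- `H₀¹(Ω)`: the completion of `C_c^∞(Ω)` for the `H¹(Ω)` inner product, realised as the closure
of the pairs `(φ, ∇φ)`, `φ ∈ C_c^∞(Ω)`, in `L²(Ω) × L²(Ω; ℝ^d)`. -/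
def H01 {d : ℕ} (Ω : Opens (Space d)) : Submodule ℝ (L2Pair Ω) :=
  (LinearMap.range (testToPair Ω)).topologicalClosure

/-- The underlying class in `L²(Ω)` of an element of `H₀¹(Ω)`. -/
def classOf {d : ℕ} {Ω : Opens (Space d)} (U : H01 Ω) : L2 Ω volume := U.1.fst

/-- The (weak) gradient of an element of `H₀¹(Ω)`. -/
def weakGrad {d : ℕ} {Ω : Opens (Space d)} (U : H01 Ω) : L2Field Ω := U.1.snd

/-- The inclusion of `C_c^∞(Ω)` in `H₀¹(Ω)`. -/
def testToH01 {d : ℕ} (Ω : Opens (Space d)) : 𝓓(Ω, ℝ) →ₗ[ℝ] H01 Ω :=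
  (testToPair Ω).codRestrict (H01 Ω)
    fun φ => Submodule.le_topologicalClosure _ (LinearMap.mem_range_self _ φ)

/-- The form `ℰ(u, v) = ∫_Ω ∇u · ∇v dx`. -/
def energy {d : ℕ} {Ω : Opens (Space d)} (U V : H01 Ω) : ℝ :=
  ∫ x in (Ω : Set (Space d)), ⟪weakGrad U x, weakGrad V x⟫_ℝ

/-- The Poincaré inequality (MPI) associated with the measure `μ` on `Ω`. -/
def MPI {d : ℕ} (Ω : Opens (Space d)) (μ : Measure (Space d)) : Prop :=
  ∃ C : ℝ, 0 < C ∧ ∀ φ : 𝓓(Ω, ℝ),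
    ∫ x in (Ω : Set (Space d)), |φ x| ^ 2 ∂μ
      ≤ C * ∫ x in (Ω : Set (Space d)), ‖∇ (φ : Space d → ℝ) x‖ ^ 2

/-- The map `ℐ : H₀¹(Ω) → L²(Ω, μ)` that sends `u` to its `L²(Ω, μ)`-representative: under (MPI),
the continuous extension of the inclusion of `C_c^∞(Ω)` in `L²(Ω, μ)`. It is
characterised by `rep_eq_iff`. -/
def rep {d : ℕ} (Ω : Opens (Space d)) (μ : Measure (Space d)) [IsFiniteMeasureOnCompacts μ] :
    H01 Ω →L[ℝ] L2 Ω μ :=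
  (testToL2 Ω μ).extendOfNorm (testToH01 Ω)

theorem denseRange_testToH01 {d : ℕ} (Ω : Opens (Space d)) : DenseRange (testToH01 Ω) := by
  rintro ⟨U, hU⟩
  rw [closure_subtype, ← Set.range_comp]
  exact hU

theorem norm_toLp_sq {d : ℕ} {F : Type} [NormedAddCommGroup F] [InnerProductSpace ℝ F]
    {ν : Measure (Space d)} {f : Space d → F} (hf : MemLp f 2 ν) :
    ‖hf.toLp f‖ ^ 2 = ∫ x, ‖f x‖ ^ 2 ∂ν := by
  rw [← real_inner_self_eq_norm_sq, L2.inner_def]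
  refine integral_congr_ae ?_
  filter_upwards [hf.coeFn_toLp] with x hx
  rw [hx, real_inner_self_eq_norm_sq]

theorem mpi_bound {d : ℕ} {Ω : Opens (Space d)} {μ : Measure (Space d)}
    [IsFiniteMeasureOnCompacts μ] {C : ℝ}
    (hC : 0 < C) (h : ∀ φ : 𝓓(Ω, ℝ), ∫ x in (Ω : Set (Space d)), |φ x| ^ 2 ∂μ
      ≤ C * ∫ x in (Ω : Set (Space d)), ‖∇ (φ : Space d → ℝ) x‖ ^ 2) (φ : 𝓓(Ω, ℝ)) :
    ‖testToL2 Ω μ φ‖ ≤ √C * ‖testToH01 Ω φ‖ := by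
  have h1 : ‖testToL2 Ω μ φ‖ ^ 2 ≤ C * ‖testGrad Ω φ‖ ^ 2 := by
    have ha : ‖testToL2 Ω μ φ‖ ^ 2 = _ := norm_toLp_sq (memLp_test μ φ)
    have hb : ‖testGrad Ω φ‖ ^ 2 = _ := norm_toLp_sq (memLp_grad_test φ)
    rw [ha, hb]
    simpa using h φ
  have h2 : ‖testGrad Ω φ‖ ^ 2 ≤ ‖testToH01 Ω φ‖ ^ 2 := by
    have : ‖testToH01 Ω φ‖ ^ 2 = ‖testToL2 Ω volume φ‖ ^ 2 + ‖testGrad Ω φ‖ ^ 2 :=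
      WithLp.prod_norm_sq_eq_of_L2 _
    rw [this]
    nlinarith [sq_nonneg ‖testToL2 Ω volume φ‖]
  refine abs_le_of_sq_le_sq' ?_ (by positivity) |>.2
  rw [mul_pow, Real.sq_sqrt hC.le]
  nlinarith

theorem rep_test {d : ℕ} {Ω : Opens (Space d)} {μ : Measure (Space d)}
    [IsFiniteMeasureOnCompacts μ] (h : MPI Ω μ) (φ : 𝓓(Ω, ℝ)) :
    rep Ω μ (testToH01 Ω φ) = testToL2 Ω μ φ := by
  obtain ⟨C, hC, h⟩ := h
  exact LinearMap.extendOfNorm_eq (denseRange_testToH01 Ω) ⟨√C, mpi_bound hC h⟩ φ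

/-- Under (MPI), `ℐ(u)` is the unique `w ∈ L²(Ω, μ)` for which some sequence in `C_c^∞(Ω)` tends
to `u` in `H₀¹(Ω)` and to `w` in `L²(Ω, μ)`. -/
theorem rep_eq_iff {d : ℕ} {Ω : Opens (Space d)} {μ : Measure (Space d)}
    [IsFiniteMeasureOnCompacts μ] (h : MPI Ω μ) (U : H01 Ω) (w : L2 Ω μ) :
    rep Ω μ U = w ↔ ∃ φ : ℕ → 𝓓(Ω, ℝ),
      Tendsto (fun n => testToH01 Ω (φ n)) atTop (𝓝 U) ∧
      Tendsto (fun n => testToL2 Ω μ (φ n)) atTop (𝓝 w) := by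
  have key : ∀ φ : ℕ → 𝓓(Ω, ℝ), Tendsto (fun n => testToH01 Ω (φ n)) atTop (𝓝 U) →
      Tendsto (fun n => testToL2 Ω μ (φ n)) atTop (𝓝 (rep Ω μ U)) := by
    intro φ hφ
    have := ((rep Ω μ).continuous.tendsto U).comp hφ
    refine this.congr fun n => ?_
    exact rep_test h (φ n)
  constructor
  · rintro rfl
    obtain ⟨x, hx, hxU⟩ := mem_closure_iff_seq_limit.mp (denseRange_testToH01 Ω U)
    choose φ hφ using hx
    have hφU : Tendsto (fun n => testToH01 Ω (φ n)) atTop (𝓝 U) := by simpa [hφ] using hxU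
    exact ⟨φ, hφU, key φ hφU⟩
  · rintro ⟨φ, hU, hw⟩
    exact tendsto_nhds_unique (key φ hU) hw

/-- The kernel `𝒩 = {u ∈ H₀¹(Ω) : ‖ℐ(u)‖_{L²(Ω, μ)} = 0}`. -/
def nullSpace {d : ℕ} (Ω : Opens (Space d)) (μ : Measure (Space d))
    [IsFiniteMeasureOnCompacts μ] : Set (H01 Ω) :=
  {U | ‖rep Ω μ U‖ = 0}

/-- `Dom(ℰ) = 𝒩^⊥`, the orthogonal complement of `𝒩` in `H₀¹(Ω)` for the Dirichlet inner product
`(u, v) ↦ ∫_Ω ∇u · ∇v dx`. -/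
def formDomain {d : ℕ} (Ω : Opens (Space d)) (μ : Measure (Space d))
    [IsFiniteMeasureOnCompacts μ] : Set (H01 Ω) :=
  {U | ∀ τ ∈ nullSpace Ω μ, energy U τ = 0}

/-- `U ∈ Dom(Δ_μ)` and `Δ_μ U = g`, where `-Δ_μ` is the nonnegative self-adjoint operator in
`L²(Ω, μ)` associated with the closed form `(ℰ, Dom(ℰ))`: `U` belongs to `Dom(ℰ)` and
`ℰ(U, V) = ⟨-g, ℐ(V)⟩_{L²(Ω, μ)}` for every `V ∈ Dom(ℰ)`. -/
def IsLaplacian {d : ℕ} (Ω : Opens (Space d)) (μ : Measure (Space d))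
    [IsFiniteMeasureOnCompacts μ] (U : H01 Ω) (g : L2 Ω μ) : Prop :=
  U ∈ formDomain Ω μ ∧ ∀ V ∈ formDomain Ω μ, energy U V = ⟪-g, rep Ω μ V⟫_ℝ

/-- The function `u`, defined at every point, is (as an element of `H₀¹(Ω)`, that is, up to
Lebesgue-a.e. equality in `Ω`) in `Dom(Δ_μ)`, and `Δ_μ u ≥ 0` `μ`-a.e. in `Ω`. -/
def IsSubharmonic {d : ℕ} (Ω : Opens (Space d)) (μ : Measure (Space d))
    [IsFiniteMeasureOnCompacts μ] (u : Space d → ℝ) : Prop :=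
  ∃ U : H01 Ω, classOf U =ᵐ[volume.restrict (Ω : Set (Space d))] u ∧
    ∃ g : L2 Ω μ, IsLaplacian Ω μ U g ∧
      ∀ᵐ x ∂(μ.restrict (Ω : Set (Space d))), 0 ≤ g x

/-- The function `u`, defined at every point, is (as an element of `H₀¹(Ω)`, that is, up to
Lebesgue-a.e. equality in `Ω`) in `Dom(Δ_μ)`, and `Δ_μ u ≤ 0` `μ`-a.e. in `Ω`. -/
def IsSuperharmonic {d : ℕ} (Ω : Opens (Space d)) (μ : Measure (Space d))
    [IsFiniteMeasureOnCompacts μ] (u : Space d → ℝ) : Prop :=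
  ∃ U : H01 Ω, classOf U =ᵐ[volume.restrict (Ω : Set (Space d))] u ∧
    ∃ g : L2 Ω μ, IsLaplacian Ω μ U g ∧
      ∀ᵐ x ∂(μ.restrict (Ω : Set (Space d))), g x ≤ 0

end

end KreinFeller

/-! The measure enters only through a sign. By the Poincaré inequality for Lebesgue measure on the
bounded set `Ω`, every `V` in `H₀¹(Ω)` differs from an element of `Dom(ℰ)` by some `τ ∈ 𝒩`. Both
sides of the identity defining `Δ_μ` vanish on `τ`, so the identity holds against all of `H₀¹(Ω)`.
Testing with `φ ≥ 0` gives `ℰ(u, φ) ≤ 0` (`IsLaplacian.energy_test_nonpos`): `u` is weakly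
subharmonic for the ordinary Laplacian.

The classical mean value argument then applies, with a smooth radial weight in place of sphere
averages. The weight `kern` is chosen so that `y * kern y` is, up to a constant, the gradient of a
bump function. The radial derivative of a weighted mean is then minus a positive multiple of the
energy against a nonnegative test function (`deriv_wmean_test`), so the means increase with the
radius (`wmean_le_wmean`). At an interior maximum this forces `u` to be constant on a ball, and
connectedness spreads the constancy to `Ω`. The superharmonic case follows by passing to `-u`. -/

namespace KreinFeller

/-! ### The Poincaré inequality for Lebesgue measure -/

section Poincare

variable {d : ℕ} {Ω : Opens (Space d)}

theorem energy_eq_inner (U V : H01 Ω) : energy U V = ⟪weakGrad U, weakGrad V⟫_ℝ :=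
  (L2.inner_def (𝕜 := ℝ) (weakGrad U) (weakGrad V)).symm

theorem test_eq_zero_of_notMem (φ : 𝓓(Ω, ℝ)) {x : Space d} (hx : x ∉ Ω) : φ x = 0 :=
  image_eq_zero_of_notMem_tsupport fun h => hx (φ.tsupport_subset h)

theorem grad_test_eq_zero_of_notMem (φ : 𝓓(Ω, ℝ)) {x : Space d} (hx : x ∉ Ω) :
    ∇ (φ : Space d → ℝ) x = 0 := by
  have h : fderiv ℝ (φ : Space d → ℝ) x = 0 := by
    by_contra h
    exact hx (φ.tsupport_subset (support_fderiv_subset ℝ h))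
  simp [gradient, h]

theorem continuous_grad_test (φ : 𝓓(Ω, ℝ)) : Continuous (∇ (φ : Space d → ℝ)) :=
  (InnerProductSpace.toDual ℝ (Space d)).symm.continuous.comp
    (φ.contDiff.continuous_fderiv (by simp))

theorem hasCompactSupport_grad_test (φ : 𝓓(Ω, ℝ)) :
    HasCompactSupport (∇ (φ : Space d → ℝ)) :=
  (φ.hasCompactSupport.fderiv (𝕜 := ℝ)).comp_left
    (g := (InnerProductSpace.toDual ℝ (Space d)).symm) (map_zero _)

/-- Integrate `φ²` by parts against the first coordinate, whose derivative along `e` is `1` and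
which is bounded by `R` on `Ω`. With `a = ⟪∇φ, e⟫ * g`, the bound `-2φa ≤ φ²/2 + 2a²` lets half of
`∫ φ²` be absorbed on the left, whence the constant `4R²`. -/
theorem poincare_test (hd : 1 ≤ d) {R : ℝ} (hR : ∀ x ∈ Ω, ‖x‖ ≤ R) (φ : 𝓓(Ω, ℝ)) :
    ∫ x in (Ω : Set (Space d)), ‖φ x‖ ^ 2
      ≤ 4 * R ^ 2 * ∫ x in (Ω : Set (Space d)), ‖∇ (φ : Space d → ℝ) x‖ ^ 2 := by
  set i : Fin d := ⟨0, hd⟩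
  set e : Space d := EuclideanSpace.single i 1
  set g : Space d → ℝ := fun x => x i
  have hg : ∀ x, HasFDerivAt g (EuclideanSpace.proj i : Space d →L[ℝ] ℝ) x := fun x =>
    (EuclideanSpace.proj i : Space d →L[ℝ] ℝ).hasFDerivAt
  have hgc : Continuous g := (EuclideanSpace.proj i : Space d →L[ℝ] ℝ).continuous
  have hge : ∀ x, fderiv ℝ g x e = 1 := fun x => by
    rw [(hg x).fderiv]; simp [e]
  have hf : ∀ x v, fderiv ℝ (fun y => φ y ^ 2) x v = 2 * φ x * ⟪∇ (φ : Space d → ℝ) x, v⟫_ℝ := by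
    intro x v
    have := ((differentiable_test φ x).hasFDerivAt).pow 2
    rw [this.fderiv]
    simp
  have hgr := continuous_grad_test φ
  have hcs : HasCompactSupport fun y => φ y ^ 2 := φ.hasCompactSupport.comp_left (g := (· ^ 2))
    (by simp)
  have hi1 : Integrable fun y => φ y ^ 2 :=
    (φ.continuous.pow 2).integrable_of_hasCompactSupport hcs
  have hc2 : Continuous fun x => -(2 * φ x * ⟪∇ (φ : Space d → ℝ) x, e⟫_ℝ * g x) := by
    have := φ.continuous
    fun_prop
  have hcs2 : HasCompactSupport fun x => -(2 * φ x * ⟪∇ (φ : Space d → ℝ) x, e⟫_ℝ * g x) :=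
    φ.hasCompactSupport.mono fun x hx => by
      contrapose! hx
      have : φ x = 0 := by simpa using hx
      simp [this]
  have hi2 := hc2.integrable_of_hasCompactSupport (μ := volume) hcs2
  have hi3 : Integrable fun x => ‖∇ (φ : Space d → ℝ) x‖ ^ 2 :=
    Continuous.integrable_of_hasCompactSupport (hgr.norm.pow 2)
      ((hasCompactSupport_grad_test φ).comp_left (g := fun v => ‖v‖ ^ 2) (by simp))
  have hi4 : Integrable fun x => (1 / 2) * φ x ^ 2 + 2 * R ^ 2 * ‖∇ (φ : Space d → ℝ) x‖ ^ 2 :=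
    (hi1.const_mul _).add (hi3.const_mul _)
  have key : ∫ x, φ x ^ 2 = ∫ x, -(2 * φ x * ⟪∇ (φ : Space d → ℝ) x, e⟫_ℝ * g x) := by
    have := integral_mul_fderiv_eq_neg_fderiv_mul_of_integrable (μ := (volume : Measure (Space d)))
      (f := fun y => φ y ^ 2) (g := g) (v := e) (by simpa [hf] using hi2.neg)
      (by simpa [hge] using hi1)
      (((φ.continuous.pow 2).mul hgc).integrable_of_hasCompactSupport hcs.mul_right)
      (fun x _ => (differentiable_test φ x).pow 2) (fun x _ => (hg x).differentiableAt)
    simpa only [hge, hf, mul_one, ← integral_neg] using this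
  have hle : ∫ x, φ x ^ 2 ≤ ∫ x, ((1 / 2) * φ x ^ 2 +
      2 * R ^ 2 * ‖∇ (φ : Space d → ℝ) x‖ ^ 2) := by
    rw [key]
    refine integral_mono hi2 hi4 fun x => ?_
    beta_reduce
    by_cases hx : x ∈ Ω
    · have h1 : |g x| ≤ R := (PiLp.norm_apply_le x i).trans (hR x hx)
      have h2 : |⟪∇ (φ : Space d → ℝ) x, e⟫_ℝ| ≤ ‖∇ (φ : Space d → ℝ) x‖ := by
        simpa [e] using abs_real_inner_le_norm (∇ (φ : Space d → ℝ) x) e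
      have h3 : |⟪∇ (φ : Space d → ℝ) x, e⟫_ℝ * g x| ≤ ‖∇ (φ : Space d → ℝ) x‖ * R := by
        rw [abs_mul]; gcongr
      have h4 := sq_le_sq' (abs_le.1 h3).1 (abs_le.1 h3).2
      nlinarith [sq_nonneg (φ x + 2 * (⟪∇ (φ : Space d → ℝ) x, e⟫_ℝ * g x))]
    · simp only [test_eq_zero_of_notMem φ hx]
      simp; positivity
  rw [integral_add (hi1.const_mul _) (hi3.const_mul _), integral_const_mul, integral_const_mul]
    at hle
  rw [setIntegral_eq_integral_of_forall_compl_eq_zero fun x hx => by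
      simp [test_eq_zero_of_notMem φ hx],
    setIntegral_eq_integral_of_forall_compl_eq_zero fun x hx => by
      simp [grad_test_eq_zero_of_notMem φ hx]]
  simp only [Real.norm_eq_abs, sq_abs]
  linarith

/-- The weak gradient as a continuous linear map. -/
noncomputable def weakGradL (Ω : Opens (Space d)) : H01 Ω →L[ℝ] L2Field Ω :=
  (WithLp.sndL 2 ℝ (L2 Ω volume) (L2Field Ω)) ∘L (H01 Ω).subtypeL

theorem weakGradL_apply (U : H01 Ω) : weakGradL Ω U = weakGrad U := rfl

theorem norm_sq_H01 (U : H01 Ω) : ‖U‖ ^ 2 = ‖classOf U‖ ^ 2 + ‖weakGrad U‖ ^ 2 :=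
  WithLp.prod_norm_sq_eq_of_L2 _

/-- This makes the gradient map bounded below, so that it carries closed subspaces of `H₀¹(Ω)` to
closed subspaces of `L²(Ω; ℝ^d)`. -/
theorem exists_norm_le_weakGrad (hd : 1 ≤ d) (hΩ : Bornology.IsBounded (Ω : Set (Space d))) :
    ∃ K : NNReal, ∀ U : H01 Ω, ‖U‖ ≤ K * ‖weakGrad U‖ := by
  obtain ⟨R, hR⟩ := hΩ.exists_norm_le
  refine ⟨NNReal.sqrt (Real.toNNReal (4 * R ^ 2 + 1)), fun U => ?_⟩
  induction U using (denseRange_testToH01 Ω).induction_on with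
  | hp => exact isClosed_le continuous_norm (continuous_const.mul (weakGradL Ω).continuous.norm)
  | ih φ =>
    refine abs_le_of_sq_le_sq' ?_ (by positivity) |>.2
    have ha : ‖classOf (testToH01 Ω φ)‖ ^ 2 = _ := norm_toLp_sq (memLp_test volume φ)
    have hb : ‖weakGrad (testToH01 Ω φ)‖ ^ 2 = _ := norm_toLp_sq (memLp_grad_test φ)
    have := poincare_test hd hR φ
    rw [← ha, ← hb] at this
    rw [norm_sq_H01, mul_pow, Real.coe_sqrt, Real.sq_sqrt (by positivity),
      Real.coe_toNNReal _ (by positivity)]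
    linarith

end Poincare

/-! ### From the operator `Δ_μ` to weak subharmonicity -/

section WeakForm

variable {d : ℕ} {Ω : Opens (Space d)} {μ : Measure (Space d)} [IsFiniteMeasureOnCompacts μ]

/-- Every element of `H₀¹(Ω)` splits into a part in `Dom(ℰ)` and a part in `𝒩`. -/
theorem exists_formDomain_decomposition (hd : 1 ≤ d)
    (hΩ : Bornology.IsBounded (Ω : Set (Space d))) (V : H01 Ω) :
    ∃ τ ∈ nullSpace Ω μ, V - τ ∈ formDomain Ω μ := by
  obtain ⟨K, hK⟩ := exists_norm_le_weakGrad hd hΩ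
  set N : Submodule ℝ (H01 Ω) := (rep Ω μ).ker
  have hN : ∀ τ, τ ∈ nullSpace Ω μ ↔ τ ∈ N := fun τ => by simp [nullSpace, N]
  have hNc : IsComplete (N : Set (H01 Ω)) := by
    have : CompleteSpace (H01 Ω) := (Submodule.isClosed_topologicalClosure _).completeSpace_coe
    exact (rep Ω μ).isClosed_ker.isComplete
  have hanti : AntilipschitzWith K (weakGradL Ω) :=
    (weakGradL Ω).antilipschitz_of_bound hK
  have hui := hanti.isUniformInducing (weakGradL Ω).uniformContinuous
  -- `P` is the space of gradients of elements of `𝒩`. It is complete, so `∇V` has an orthogonal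
  -- projection onto it, which is `∇τ` for some `τ ∈ 𝒩`.
  set P : Submodule ℝ (L2Field Ω) := N.map (weakGradL Ω).toLinearMap
  have hPc : IsComplete (P : Set (L2Field Ω)) :=
    (isComplete_image_iff hui).2 hNc
  have : CompleteSpace P := hPc.completeSpace_coe
  obtain ⟨τ, hτ, hτe⟩ := (P.orthogonalProjectionOnto (weakGrad V)).2
  refine ⟨τ, (hN τ).2 hτ, fun σ hσ => ?_⟩
  rw [energy_eq_inner, ← weakGradL_apply, map_sub, real_inner_comm]
  have hmem := P.sub_starProjection_mem_orthogonal (weakGrad V)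
  rw [Submodule.mem_orthogonal] at hmem
  have := hmem (weakGradL Ω σ) ⟨σ, (hN σ).1 hσ, rfl⟩
  rw [← weakGradL_apply σ]
  rw [show weakGradL Ω τ = P.starProjection (weakGrad V) from hτe]
  exact this

/-- The defining identity of `Δ_μ` holds against every element of `H₀¹(Ω)`. -/
theorem IsLaplacian.energy_eq (hd : 1 ≤ d) (hΩ : Bornology.IsBounded (Ω : Set (Space d)))
    {U : H01 Ω} {g : L2 Ω μ} (h : IsLaplacian Ω μ U g) (V : H01 Ω) :
    energy U V = ⟪-g, rep Ω μ V⟫_ℝ := by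
  obtain ⟨τ, hτ, hV⟩ := exists_formDomain_decomposition (μ := μ) hd hΩ V
  have h1 := h.2 _ hV
  have h2 := h.1 τ hτ
  have h3 : rep Ω μ τ = 0 := by simpa [nullSpace] using hτ
  rw [map_sub, h3, sub_zero] at h1
  rw [← h1, energy_eq_inner, energy_eq_inner, ← weakGradL_apply (V - τ), map_sub, inner_sub_right,
    weakGradL_apply, weakGradL_apply, ← energy_eq_inner U τ, h2, sub_zero]

/-- From here on `μ` plays no role. (MPI) serves to identify `ℐ(φ)` with `φ` itself, so that its
sign is known. -/
theorem IsLaplacian.energy_test_nonpos (hd : 1 ≤ d)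
    (hΩ : Bornology.IsBounded (Ω : Set (Space d))) (hMPI : MPI Ω μ)
    {U : H01 Ω} {g : L2 Ω μ} (h : IsLaplacian Ω μ U g)
    (hg : ∀ᵐ x ∂(μ.restrict (Ω : Set (Space d))), 0 ≤ g x)
    (φ : 𝓓(Ω, ℝ)) (hφ : ∀ x, 0 ≤ φ x) : energy U (testToH01 Ω φ) ≤ 0 := by
  rw [h.energy_eq hd hΩ, rep_test hMPI, inner_neg_left, L2.inner_def, neg_nonpos]
  refine integral_nonneg_of_ae ?_
  filter_upwards [hg, (memLp_test μ φ).coeFn_toLp] with x hx hx2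
  have : testToL2 Ω μ φ x = φ x := hx2
  simp only [this]
  simpa using mul_nonneg (hφ x) hx

end WeakForm

/-! ### A radial bump function and its weight -/

section Bump

variable {d : ℕ}

/-- A smooth radial function supported in the closed unit ball. -/
noncomputable def bump (y : Space d) : ℝ := expNegInvGlue (1 - ‖y‖ ^ 2)

/-- The radial weight `k` for which `∇ bump = -2 k(y) y`. -/
noncomputable def kern (y : Space d) : ℝ := deriv expNegInvGlue (1 - ‖y‖ ^ 2)

theorem hasDerivAt_expNegInvGlue (t : ℝ) :
    HasDerivAt expNegInvGlue (t⁻¹ ^ 2 * expNegInvGlue t) t := by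
  simpa using expNegInvGlue.hasDerivAt_polynomial_eval_inv_mul 1 t

theorem kern_eq (y : Space d) : kern y = (1 - ‖y‖ ^ 2)⁻¹ ^ 2 * bump y :=
  (hasDerivAt_expNegInvGlue _).deriv

theorem contDiff_bump : ContDiff ℝ (⊤ : ℕ∞) (bump : Space d → ℝ) :=
  expNegInvGlue.contDiff.comp (contDiff_const.sub (contDiff_norm_sq ℝ))

theorem bump_nonneg (y : Space d) : 0 ≤ bump y := expNegInvGlue.nonneg _

theorem bump_eq_zero {y : Space d} (hy : 1 ≤ ‖y‖) : bump y = 0 :=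
  expNegInvGlue.zero_of_nonpos (by nlinarith)

theorem continuous_kern : Continuous (kern : Space d → ℝ) :=
  ((expNegInvGlue.contDiff (n := 1)).continuous_deriv (by simp)).comp
    (continuous_const.sub (continuous_norm.pow 2))

theorem kern_nonneg (y : Space d) : 0 ≤ kern y := by
  rw [kern_eq]
  exact mul_nonneg (sq_nonneg _) (bump_nonneg y)

theorem kern_eq_zero {y : Space d} (hy : 1 ≤ ‖y‖) : kern y = 0 := by
  rw [kern_eq, bump_eq_zero hy, mul_zero]

theorem kern_pos {y : Space d} (hy : ‖y‖ < 1) : 0 < kern y := by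
  have h : 0 < 1 - ‖y‖ ^ 2 := by nlinarith [norm_nonneg y]
  rw [kern_eq]
  exact mul_pos (by positivity) (expNegInvGlue.pos_of_pos h)

theorem hasCompactSupport_kern : HasCompactSupport (kern : Space d → ℝ) :=
  HasCompactSupport.intro (isCompact_closedBall 0 1) fun y hy =>
    kern_eq_zero (by simpa using (not_le.1 (by simpa using hy)).le)

theorem integrable_kern : Integrable (kern : Space d → ℝ) :=
  continuous_kern.integrable_of_hasCompactSupport hasCompactSupport_kern

theorem hasGradientAt_bump (y : Space d) : HasGradientAt bump (-(2 * kern y) • y) y := by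
  have h1 : HasFDerivAt (fun y : Space d => 1 - ‖y‖ ^ 2) (-(2 • (innerSL ℝ y))) y :=
    (hasStrictFDerivAt_norm_sq y).hasFDerivAt.const_sub 1
  have h2 := (hasDerivAt_expNegInvGlue (1 - ‖y‖ ^ 2)).comp_hasFDerivAt y h1
  rw [hasGradientAt_iff_hasFDerivAt]
  refine h2.congr_fderiv ?_
  ext v
  simp [kern_eq, bump]
  ring

theorem hasGradientAt_bump_comp (x₀ : Space d) (s : ℝ) (x : Space d) :
    HasGradientAt (fun x => bump (s⁻¹ • (x - x₀)))
      (-(2 * s⁻¹ * kern (s⁻¹ • (x - x₀))) • (s⁻¹ • (x - x₀))) x := by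
  have h1 : HasFDerivAt (fun x : Space d => s⁻¹ • (x - x₀))
      (s⁻¹ • ContinuousLinearMap.id ℝ (Space d)) x :=
    ((hasFDerivAt_id x).sub_const x₀).const_smul s⁻¹
  have h2 := (hasGradientAt_bump (s⁻¹ • (x - x₀))).hasFDerivAt.comp x h1
  rw [hasGradientAt_iff_hasFDerivAt]
  refine h2.congr_fderiv ?_
  ext v
  simp
  ring

theorem one_le_norm_inv_smul_sub {x₀ x : Space d} {s : ℝ} (hs : 0 < s)
    (hx : x ∉ Metric.closedBall x₀ s) : 1 ≤ ‖s⁻¹ • (x - x₀)‖ := by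
  rw [Metric.mem_closedBall, dist_eq_norm, not_le] at hx
  rw [norm_smul, norm_inv, Real.norm_of_nonneg hs.le, inv_mul_eq_div, one_le_div hs]
  exact hx.le

/-- The function `bump ((x - x₀) / s)` as a test function. -/
noncomputable def testBump {Ω : Opens (Space d)} {x₀ : Space d} {s : ℝ} (hs : 0 < s)
    (h : Metric.closedBall x₀ s ⊆ Ω) : 𝓓(Ω, ℝ) where
  toFun x := bump (s⁻¹ • (x - x₀))
  contDiff' := contDiff_bump.comp (by fun_prop)
  hasCompactSupport' := HasCompactSupport.intro (isCompact_closedBall x₀ s) fun _ hx =>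
    bump_eq_zero (one_le_norm_inv_smul_sub hs hx)
  tsupport_subset' := by
    refine (closure_minimal (fun x hx => ?_) Metric.isClosed_closedBall).trans h
    by_contra hx'
    exact hx (bump_eq_zero (one_le_norm_inv_smul_sub hs hx'))

theorem grad_testBump {Ω : Opens (Space d)} {x₀ : Space d} {s : ℝ} (hs : 0 < s)
    (h : Metric.closedBall x₀ s ⊆ Ω) (x : Space d) :
    ∇ (testBump hs h : Space d → ℝ) x
      = -(2 * s⁻¹ * kern (s⁻¹ • (x - x₀))) • (s⁻¹ • (x - x₀)) :=
  (hasGradientAt_bump_comp x₀ s x).gradient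

/-- Uniformity over all radii `s ≥ ε` is what allows the error in `wmean_le_wmean` to be integrated
in `s` and then sent to zero. -/
theorem exists_norm_testGrad_testBump_le {Ω : Opens (Space d)}
    (hΩ : Bornology.IsBounded (Ω : Set (Space d))) (x₀ : Space d) {ε : ℝ} (hε : 0 < ε) :
    ∃ B : ℝ, ∀ s (hs : 0 < s) (h : Metric.closedBall x₀ s ⊆ Ω), ε ≤ s →
      ‖testGrad Ω (testBump hs h)‖ ≤ B := by
  obtain ⟨K, hK⟩ := continuous_kern.bounded_above_of_compact_support
    (hasCompactSupport_kern (d := d))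
  have : IsFiniteMeasure (volume.restrict (Ω : Set (Space d))) :=
    ⟨by simpa using hΩ.measure_lt_top⟩
  refine ⟨_, fun s hs h hεs => Lp.norm_le_of_ae_bound (C := 2 * ε⁻¹ * K) ?_ ?_⟩
  · have := (norm_nonneg _).trans (hK 0)
    positivity
  · filter_upwards [(memLp_grad_test (testBump hs h)).coeFn_toLp] with x hx
    have : testGrad Ω (testBump hs h) x = ∇ (testBump hs h : Space d → ℝ) x := hx
    rw [this, grad_testBump]
    set z := s⁻¹ • (x - x₀)
    have hk := hK z
    rw [Real.norm_of_nonneg (kern_nonneg z)] at hk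
    have hk0 := kern_nonneg z
    rw [norm_smul, norm_neg, Real.norm_of_nonneg (by positivity)]
    -- The factor `‖z‖` costs nothing, because `kern` vanishes outside the unit ball.
    have h1 : kern z * ‖z‖ ≤ K := by
      rcases le_total 1 ‖z‖ with hz | hz
      · rw [kern_eq_zero hz, zero_mul]; exact hk0.trans hk
      · nlinarith [norm_nonneg z]
    have h2 : s⁻¹ ≤ ε⁻¹ := by gcongr
    have h3 : 0 ≤ s⁻¹ := by positivity
    have h4 : 0 ≤ kern z * ‖z‖ := by positivity
    calc 2 * s⁻¹ * kern z * ‖z‖ = 2 * (s⁻¹ * (kern z * ‖z‖)) := by ring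
      _ ≤ 2 * (ε⁻¹ * K) := by gcongr
      _ = _ := by ring

end Bump

/-! ### Monotonicity of weighted means in the radius -/

section Average

variable {d : ℕ}

theorem integral_comp_inv_smul_sub (F : Space d → ℝ) (x₀ : Space d) {s : ℝ} (hs : 0 < s) :
    ∫ x, F (s⁻¹ • (x - x₀)) = s ^ d * ∫ y, F y := by
  rw [integral_sub_right_eq_self (fun x => F (s⁻¹ • x)) x₀,
    Measure.integral_comp_inv_smul_of_nonneg _ _ hs.le]
  simp

/-- A weighted mean of `f` over the ball of radius `s` around `x₀` (not normalised). -/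
noncomputable def wmean (f : Space d → ℝ) (x₀ : Space d) (s : ℝ) : ℝ :=
  ∫ y, f (x₀ + s • y) * kern y

theorem add_smul_inv_smul_sub {x₀ x : Space d} {s : ℝ} (hs : 0 < s) :
    x₀ + s • s⁻¹ • (x - x₀) = x := by
  rw [smul_inv_smul₀ hs.ne']; abel

theorem wmean_eq {Ω : Opens (Space d)} (f : Space d → ℝ) {x₀ : Space d} {s : ℝ} (hs : 0 < s)
    (h : Metric.closedBall x₀ s ⊆ Ω) :
    wmean f x₀ s = (s ^ d)⁻¹ * ∫ x in (Ω : Set (Space d)), f x * kern (s⁻¹ • (x - x₀)) := by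
  have := integral_comp_inv_smul_sub (fun y => f (x₀ + s • y) * kern y) x₀ hs
  simp only [add_smul_inv_smul_sub hs] at this
  rw [setIntegral_eq_integral_of_forall_compl_eq_zero, this, wmean,
    inv_mul_cancel_left₀ (by positivity)]
  intro x hx
  rw [kern_eq_zero (one_le_norm_inv_smul_sub hs fun hx' => hx (h hx')), mul_zero]

theorem memLp_kern_comp (Ω : Opens (Space d)) (x₀ : Space d) {s : ℝ} (hs : 0 < s) :
    MemLp (fun x => kern (s⁻¹ • (x - x₀))) 2 (volume.restrict (Ω : Set (Space d))) := by
  refine (Continuous.memLp_of_hasCompactSupport ?_ ?_).restrict _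
  · exact continuous_kern.comp (by fun_prop)
  · exact HasCompactSupport.intro (isCompact_closedBall x₀ s) fun _ hx =>
      kern_eq_zero (one_le_norm_inv_smul_sub hs hx)

/-- For a fixed radius the mean is a continuous functional of the `L²(Ω)` class, so it passes to
limits in `H₀¹(Ω)` and ignores null sets. -/
theorem wmean_eq_inner {Ω : Opens (Space d)} {f : Space d → ℝ} {x₀ : Space d} {s : ℝ} (hs : 0 < s)
    (h : Metric.closedBall x₀ s ⊆ Ω) {F : L2 Ω volume}
    (hF : F =ᵐ[volume.restrict (Ω : Set (Space d))] f) :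
    wmean f x₀ s = (s ^ d)⁻¹ * ⟪(memLp_kern_comp Ω x₀ hs).toLp _, F⟫_ℝ := by
  rw [wmean_eq f hs h, L2.inner_def]
  congr 1
  refine integral_congr_ae ?_
  filter_upwards [hF, (memLp_kern_comp Ω x₀ hs).coeFn_toLp] with x h1 h2
  rw [h1, h2]
  simp

variable {Ω : Opens (Space d)}

theorem hasDerivAt_wmean_test (φ : 𝓓(Ω, ℝ)) (x₀ : Space d) (s : ℝ) :
    HasDerivAt (wmean φ x₀)
      (∫ y, ⟪∇ (φ : Space d → ℝ) (x₀ + s • y), y⟫_ℝ * kern y) s := by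
  obtain ⟨C, hC⟩ := (continuous_grad_test φ).bounded_above_of_compact_support
    (hasCompactSupport_grad_test φ)
  have hφ := φ.continuous
  have hg := continuous_grad_test φ
  have hk := continuous_kern (d := d)
  have hc : ∀ t : ℝ, Continuous fun y : Space d => φ (x₀ + t • y) * kern y := fun t => by fun_prop
  have hc' : Continuous fun y : Space d => ⟪∇ (φ : Space d → ℝ) (x₀ + s • y), y⟫_ℝ * kern y := by
    fun_prop
  refine (hasDerivAt_integral_of_dominated_loc_of_deriv_le (bound := fun y => C * kern y)
    (F' := fun t y => ⟪∇ (φ : Space d → ℝ) (x₀ + t • y), y⟫_ℝ * kern y)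
    (s := Set.univ) univ_mem (.of_forall fun t => (hc t).aestronglyMeasurable) ?_
    hc'.aestronglyMeasurable (.of_forall fun y t _ => ?_) (integrable_kern.const_mul C)
    (.of_forall fun y t _ => ?_)).2
  · exact (hc s).integrable_of_hasCompactSupport hasCompactSupport_kern.mul_left
  · have hk0 := kern_nonneg y
    rw [norm_mul, Real.norm_of_nonneg hk0]
    rcases le_total 1 ‖y‖ with hy | hy
    · simp [kern_eq_zero hy]
    · gcongr
      calc _ ≤ ‖∇ (φ : Space d → ℝ) (x₀ + t • y)‖ * ‖y‖ := norm_inner_le_norm _ _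
        _ ≤ C * 1 := by gcongr; exacts [(norm_nonneg _).trans (hC 0), hC _]
        _ = C := mul_one C
  · have h1 : HasDerivAt (fun t : ℝ => x₀ + t • y) y t := by
      simpa using ((hasDerivAt_id t).smul_const y).const_add x₀
    have h2 := ((differentiable_test φ (x₀ + t • y)).hasFDerivAt.comp_hasDerivAt t h1).mul_const
      (kern y)
    rwa [← inner_gradient_left] at h2

theorem energy_test (φ ψ : 𝓓(Ω, ℝ)) : energy (testToH01 Ω φ) (testToH01 Ω ψ)
    = ∫ x, ⟪∇ (φ : Space d → ℝ) x, ∇ (ψ : Space d → ℝ) x⟫_ℝ := by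
  rw [← setIntegral_eq_integral_of_forall_compl_eq_zero (s := (Ω : Set (Space d))) fun x hx => by
    rw [grad_test_eq_zero_of_notMem φ hx, inner_zero_left]]
  refine integral_congr_ae ?_
  filter_upwards [(memLp_grad_test φ).coeFn_toLp, (memLp_grad_test ψ).coeFn_toLp] with x h1 h2
  have h1' : weakGrad (testToH01 Ω φ) x = ∇ (φ : Space d → ℝ) x := h1
  have h2' : weakGrad (testToH01 Ω ψ) x = ∇ (ψ : Space d → ℝ) x := h2
  rw [h1', h2']

/-- Substituting `y = s⁻¹ • (x - x₀)` contributes `s⁻ᵈ`, and `y * kern y` becomes `-(s/2)` times the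
gradient of the rescaled bump. This plays the part of Green's identity on balls. -/
theorem deriv_wmean_test (φ : 𝓓(Ω, ℝ)) {x₀ : Space d} {s : ℝ} (hs : 0 < s)
    (h : Metric.closedBall x₀ s ⊆ Ω) :
    deriv (wmean φ x₀) s
      = -(s / (2 * s ^ d) * energy (testToH01 Ω φ) (testToH01 Ω (testBump hs h))) := by
  have h1 := integral_comp_inv_smul_sub
    (fun y => ⟪∇ (φ : Space d → ℝ) (x₀ + s • y), y⟫_ℝ * kern y) x₀ hs
  simp only [add_smul_inv_smul_sub hs] at h1
  rw [(hasDerivAt_wmean_test φ x₀ s).deriv, energy_test]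
  have h2 : ∀ x, ⟪∇ (φ : Space d → ℝ) x, ∇ (testBump hs h : Space d → ℝ) x⟫_ℝ
      = -(2 * s⁻¹) * (⟪∇ (φ : Space d → ℝ) x, s⁻¹ • (x - x₀)⟫_ℝ * kern (s⁻¹ • (x - x₀))) := by
    intro x
    rw [grad_testBump, inner_smul_right]
    ring
  simp only [h2]
  rw [integral_const_mul, h1]
  field_simp

theorem wmean_le_wmean (hΩ : Bornology.IsBounded (Ω : Set (Space d))) {U : H01 Ω}
    (hU : ∀ φ : 𝓓(Ω, ℝ), (∀ x, 0 ≤ φ x) → energy U (testToH01 Ω φ) ≤ 0)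
    {u : Space d → ℝ} (hu : classOf U =ᵐ[volume.restrict (Ω : Set (Space d))] u)
    {x₀ : Space d} {ε R : ℝ} (hε : 0 < ε) (hεR : ε ≤ R) (hR : Metric.closedBall x₀ R ⊆ Ω) :
    wmean u x₀ ε ≤ wmean u x₀ R := by
  obtain ⟨B, hB⟩ := exists_norm_testGrad_testBump_le hΩ x₀ hε
  have hεball : Metric.closedBall x₀ ε ⊆ Ω := (Metric.closedBall_subset_closedBall hεR).trans hR
  have hR0 : 0 < R := hε.trans_le hεR
  have hB0 : 0 ≤ B := (norm_nonneg _).trans (hB ε hε hεball le_rfl)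
  have hclass : Continuous (classOf : H01 Ω → L2 Ω volume) :=
    ((WithLp.fstL 2 ℝ (L2 Ω volume) (L2Field Ω)) ∘L (H01 Ω).subtypeL).continuous
  -- Test functions approximating `U` need not be subharmonic, so their means are only almost
  -- increasing, with an error proportional to `‖V - U‖`. The inequality is closed in `V`; density
  -- extends it to `V = U`, where the error disappears.
  have key : ∀ V : H01 Ω, -(R / (2 * ε ^ d) * (‖V - U‖ * B)) * (R - ε) ≤
      (R ^ d)⁻¹ * ⟪(memLp_kern_comp Ω x₀ hR0).toLp _, classOf V⟫_ℝ
      - (ε ^ d)⁻¹ * ⟪(memLp_kern_comp Ω x₀ hε).toLp _, classOf V⟫_ℝ := by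
    intro V
    induction V using (denseRange_testToH01 Ω).induction_on with
    | hp => exact isClosed_le (by fun_prop) (by fun_prop)
    | ih φ =>
      have hφ : classOf (testToH01 Ω φ) =ᵐ[volume.restrict (Ω : Set (Space d))] φ :=
        (memLp_test volume φ).coeFn_toLp
      rw [← wmean_eq_inner hR0 hR hφ, ← wmean_eq_inner hε hεball hφ]
      have hdiff : Differentiable ℝ (wmean φ x₀) := fun s =>
        (hasDerivAt_wmean_test φ x₀ s).differentiableAt
      refine (convex_Icc ε R).mul_sub_le_image_sub_of_le_deriv hdiff.continuous.continuousOn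
        hdiff.differentiableOn (fun s hs => ?_) ε ⟨le_rfl, hεR⟩ R ⟨hεR, le_rfl⟩ hεR
      rw [interior_Icc] at hs
      have hs0 : 0 < s := hε.trans hs.1
      have hsball : Metric.closedBall x₀ s ⊆ Ω :=
        (Metric.closedBall_subset_closedBall hs.2.le).trans hR
      rw [deriv_wmean_test φ hs0 hsball, neg_le_neg_iff]
      have h1 : energy (testToH01 Ω φ) (testToH01 Ω (testBump hs0 hsball))
          ≤ ‖testToH01 Ω φ - U‖ * B := by
        have h2 := hU (testBump hs0 hsball) fun x => bump_nonneg _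
        have h3 : energy (testToH01 Ω φ) (testToH01 Ω (testBump hs0 hsball))
            = ⟪weakGradL Ω (testToH01 Ω φ - U), testGrad Ω (testBump hs0 hsball)⟫_ℝ
              + energy U (testToH01 Ω (testBump hs0 hsball)) := by
          rw [energy_eq_inner, energy_eq_inner, map_sub, inner_sub_left]
          exact (sub_add_cancel _ _).symm
        have h4 : ‖weakGradL Ω (testToH01 Ω φ - U)‖ ≤ ‖testToH01 Ω φ - U‖ := by
          refine abs_le_of_sq_le_sq' ?_ (by positivity) |>.2
          rw [norm_sq_H01, weakGradL_apply]
          exact le_add_of_nonneg_left (sq_nonneg _)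
        have h5 := real_inner_le_norm (weakGradL Ω (testToH01 Ω φ - U))
          (testGrad Ω (testBump hs0 hsball))
        have h6 := mul_le_mul h4 (hB s hs0 hsball hs.1.le) (norm_nonneg _) (norm_nonneg _)
        linarith
      -- Bounding numerator and denominator separately makes the prefactor independent of `s ∈ (ε,
      -- R)`.
      have h0 : s / (2 * s ^ d) ≤ R / (2 * ε ^ d) := by
        gcongr
        exacts [hs.2.le, hs.1.le]
      calc _ ≤ s / (2 * s ^ d) * (‖testToH01 Ω φ - U‖ * B) := by gcongr
        _ ≤ _ := by gcongr
  have := key U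
  rw [← wmean_eq_inner hR0 hR hu, ← wmean_eq_inner hε hεball hu, sub_self, norm_zero] at this
  linarith

end Average

/-! ### The strong maximum principle -/

section MaximumPrinciple

variable {d : ℕ} {Ω : Opens (Space d)} {u : Space d → ℝ} {x₀ : Space d}

theorem add_smul_mem_closedBall {s : ℝ} (hs : 0 ≤ s) {y : Space d} (hy : ‖y‖ ≤ 1) :
    x₀ + s • y ∈ Metric.closedBall x₀ s := by
  rw [mem_closedBall_iff_norm, add_sub_cancel_left, norm_smul, Real.norm_of_nonneg hs]
  nlinarith

theorem integrable_wmean (hu : ContinuousOn u Ω) {s : ℝ} (hs : 0 ≤ s)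
    (h : Metric.closedBall x₀ s ⊆ Ω) : Integrable fun y => u (x₀ + s • y) * kern y := by
  rw [← integrableOn_iff_integrable_of_support_subset (s := Metric.closedBall 0 1)]
  · refine ContinuousOn.integrableOn_compact (isCompact_closedBall 0 1) ?_
    refine ContinuousOn.mul (hu.comp (by fun_prop) fun y hy => ?_) continuous_kern.continuousOn
    exact h (add_smul_mem_closedBall hs (by simpa using hy))
  · intro y hy
    by_contra hy'
    exact hy (by simp [kern_eq_zero (not_le.1 (by simpa using hy')).le])

theorem le_wmean_of_forall_le (hu : ContinuousOn u Ω) {s m : ℝ} (hs : 0 ≤ s)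
    (h : Metric.closedBall x₀ s ⊆ Ω) (hm : ∀ x ∈ Metric.closedBall x₀ s, m ≤ u x) :
    m * ∫ y : Space d, kern y ≤ wmean u x₀ s := by
  rw [← integral_const_mul]
  refine integral_mono (integrable_kern.const_mul m) (integrable_wmean hu hs h) fun y => ?_
  rcases le_total 1 ‖y‖ with hy | hy
  · simp [kern_eq_zero hy]
  · exact mul_le_mul_of_nonneg_right (hm _ (add_smul_mem_closedBall hs hy)) (kern_nonneg y)

/-- If the weighted means of `u` around a maximum point increase with the radius, then `u` is
constant near that point. -/
theorem eqOn_ball_of_wmean_le (hu : ContinuousOn u Ω) {R : ℝ} (hR : 0 < R)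
    (h : Metric.closedBall x₀ R ⊆ Ω) (hmax : ∀ x ∈ Ω, u x ≤ u x₀)
    (hmono : ∀ ε, 0 < ε → ε ≤ R → wmean u x₀ ε ≤ wmean u x₀ R) :
    ∀ x ∈ Metric.ball x₀ R, u x = u x₀ := by
  have hx₀ : x₀ ∈ Ω := h (Metric.mem_closedBall_self hR.le)
  set c := ∫ y : Space d, kern y
  have hc : 0 ≤ c := integral_nonneg kern_nonneg
  -- As `ε → 0` the means tend to `u x₀ * c` by continuity, and monotonicity carries this lower
  -- bound to radius `R`. Dividing by `c + 1` avoids having to know that `c` is positive.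
  have hle : u x₀ * c ≤ wmean u x₀ R := by
    refine le_of_forall_pos_le_add fun η hη => ?_
    have hδ : 0 < η / (c + 1) := by positivity
    have hnear : ∀ᶠ x in 𝓝 x₀, u x₀ - η / (c + 1) < u x :=
      (hu.continuousAt (Ω.isOpen.mem_nhds hx₀)).eventually
        (lt_mem_nhds (by linarith))
    obtain ⟨r, hr, hball⟩ := Metric.nhds_basis_closedBall.eventually_iff.1 hnear
    have hε : 0 < min r R := lt_min hr hR
    have h1 := le_wmean_of_forall_le hu hε.le
      ((Metric.closedBall_subset_closedBall (min_le_right r R)).trans h)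
      (fun x hx => (hball (Metric.closedBall_subset_closedBall (min_le_left r R) hx)).le)
    have h2 := hmono _ hε (min_le_right r R)
    have h3 : η / (c + 1) * c ≤ η := by
      rw [div_mul_eq_mul_div, div_le_iff₀ (by positivity)]
      nlinarith
    change (u x₀ - η / (c + 1)) * c ≤ _ at h1
    nlinarith
  -- The weighted defect `w` is nonnegative with zero integral, hence zero almost everywhere, and by
  -- continuity everywhere on the open unit ball. There `kern` is strictly positive and can be
  -- cancelled.
  set w : Space d → ℝ := fun y => u x₀ * kern y - u (x₀ + R • y) * kern y
  have hw0 : 0 ≤ w := fun y => by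
    rcases le_total 1 ‖y‖ with hy | hy
    · simp [w, kern_eq_zero hy]
    · have := hmax _ (h (add_smul_mem_closedBall (x₀ := x₀) hR.le hy))
      have h2 := kern_nonneg y
      simp only [w, Pi.zero_apply]
      nlinarith
  have hwi : Integrable w := (integrable_kern.const_mul _).sub (integrable_wmean hu hR.le h)
  have hwint : ∫ y, w y = 0 := by
    refine le_antisymm ?_ (integral_nonneg hw0)
    rw [integral_sub (integrable_kern.const_mul _) (integrable_wmean hu hR.le h),
      integral_const_mul]
    exact sub_nonpos.2 hle
  have hae := (integral_eq_zero_iff_of_nonneg hw0 hwi).1 hwint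
  have hmaps : ∀ y ∈ Metric.ball (0 : Space d) 1, x₀ + R • y ∈ Ω := fun y hy =>
    h (add_smul_mem_closedBall hR.le (by simpa using (Metric.ball_subset_closedBall hy)))
  have heq : Set.EqOn w 0 (Metric.ball 0 1) := by
    refine Measure.eqOn_open_of_ae_eq (ae_restrict_of_ae hae) Metric.isOpen_ball ?_
      continuousOn_const
    have hk := continuous_kern (d := d)
    exact (by fun_prop : Continuous fun y : Space d => u x₀ * kern y).continuousOn.sub
      ((hu.comp (by fun_prop) hmaps).mul hk.continuousOn)
  intro x hx
  have hy : ‖R⁻¹ • (x - x₀)‖ < 1 := by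
    rw [norm_smul, norm_inv, Real.norm_of_nonneg hR.le, inv_mul_eq_div, div_lt_one hR]
    simpa [dist_eq_norm] using hx
  have h1 := heq (by simpa using hy : R⁻¹ • (x - x₀) ∈ Metric.ball (0 : Space d) 1)
  simp only [w, add_smul_inv_smul_sub hR, Pi.zero_apply, ← sub_mul] at h1
  have := (mul_eq_zero.1 h1).resolve_right (kern_pos hy).ne'
  linarith

/-- Every point where the maximum is attained is again a maximum point, so the set of such points is
open. It is relatively closed by continuity, hence all of the connected set `Ω`. -/
theorem forall_eq_of_isMax (hΩ : Bornology.IsBounded (Ω : Set (Space d)))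
    (hconn : IsConnected (Ω : Set (Space d))) {U : H01 Ω}
    (hU : ∀ φ : 𝓓(Ω, ℝ), (∀ x, 0 ≤ φ x) → energy U (testToH01 Ω φ) ≤ 0)
    (huU : classOf U =ᵐ[volume.restrict (Ω : Set (Space d))] u)
    (hu : ContinuousOn u Ω) (hx₀ : x₀ ∈ Ω) (hmax : ∀ x ∈ Ω, u x ≤ u x₀) :
    ∀ x ∈ Ω, u x = u x₀ := by
  have hopen : IsOpen {x | x ∈ Ω ∧ u x = u x₀} := by
    refine Metric.isOpen_iff.2 fun x ⟨hx, hxe⟩ => ?_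
    obtain ⟨R, hR, hball⟩ := Metric.nhds_basis_closedBall.mem_iff.1 (Ω.isOpen.mem_nhds hx)
    refine ⟨R, hR, fun z hz => ⟨hball (Metric.ball_subset_closedBall hz), ?_⟩⟩
    rw [← hxe]
    refine eqOn_ball_of_wmean_le hu hR hball (fun y hy => hxe ▸ hmax y hy)
      (fun ε hε hεR => wmean_le_wmean hΩ hU huU hε hεR hball) z hz
  have hopen' : IsOpen {x | x ∈ Ω ∧ u x ≠ u x₀} :=
    hu.isOpen_inter_preimage Ω.isOpen isOpen_compl_singleton
  intro x hx
  by_contra hne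
  obtain ⟨z, _, hz1, hz2⟩ := hconn.isPreconnected _ _ hopen hopen'
    (fun y hy => (em (u y = u x₀)).imp (fun h => ⟨hy, h⟩) (fun h => ⟨hy, h⟩))
    ⟨x₀, hx₀, hx₀, rfl⟩ ⟨x, hx, hx, hne⟩
  exact hz2.2 hz1.2

variable {μ : Measure (Space d)} [IsFiniteMeasureOnCompacts μ]

theorem IsSubharmonic.eq_of_isMax (hd : 1 ≤ d) (hΩ : Bornology.IsBounded (Ω : Set (Space d)))
    (hconn : IsConnected (Ω : Set (Space d))) (hMPI : MPI Ω μ) (hu : ContinuousOn u Ω)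
    (h : IsSubharmonic Ω μ u) (hx₀ : x₀ ∈ Ω) (hmax : ∀ x ∈ Ω, u x ≤ u x₀) :
    ∀ x ∈ Ω, u x = u x₀ := by
  obtain ⟨U, huU, g, hUg, hg⟩ := h
  exact forall_eq_of_isMax hΩ hconn (hUg.energy_test_nonpos hd hΩ hMPI hg) huU hu hx₀ hmax

theorem IsSuperharmonic.neg (h : IsSuperharmonic Ω μ u) :
    IsSubharmonic Ω μ (fun x => -u x) := by
  obtain ⟨U, huU, g, ⟨hU, hUg⟩, hg⟩ := h
  have hneg : ∀ V, energy (-U) V = -energy U V := fun V => by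
    rw [energy_eq_inner, energy_eq_inner, ← inner_neg_left]; rfl
  refine ⟨-U, ?_, -g, ⟨fun τ hτ => by rw [hneg, hU τ hτ, neg_zero], fun V hV => ?_⟩, ?_⟩
  · filter_upwards [huU, Lp.coeFn_neg (classOf U)] with x h1 h2
    rw [← h1]; exact h2
  · rw [hneg, hUg V hV, ← inner_neg_left]
  · filter_upwards [hg, Lp.coeFn_neg g] with x h1 h2
    exact (neg_nonneg.2 h1).trans_eq h2.symm

end MaximumPrinciple

end KreinFeller

theorem theorem3p3 (d : ℕ) (hd : 1 ≤ d) (Ω : TopologicalSpace.Opens (KreinFeller.Space d))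
    (hΩ_bdd : Bornology.IsBounded (Ω : Set (KreinFeller.Space d)))
    (hΩ_conn : IsConnected (Ω : Set (KreinFeller.Space d)))
    (μ : MeasureTheory.Measure (KreinFeller.Space d)) [MeasureTheory.IsFiniteMeasure μ]
    (hμ_supp : μ.support ⊆ closure (Ω : Set (KreinFeller.Space d)))
    (hμ_pos : 0 < μ (Ω : Set (KreinFeller.Space d)))
    (hMPI : KreinFeller.MPI Ω μ)
    (u : KreinFeller.Space d → ℝ)
    (hu_cont : ContinuousOn u (Ω : Set (KreinFeller.Space d)))
    (hu_nonconst : ¬ ∃ c : ℝ, ∀ x ∈ Ω, u x = c) :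
    (KreinFeller.IsSubharmonic Ω μ u → ¬ ∃ x₀ ∈ Ω, ∀ x ∈ Ω, u x ≤ u x₀) ∧
    (KreinFeller.IsSuperharmonic Ω μ u → ¬ ∃ x₀ ∈ Ω, ∀ x ∈ Ω, u x₀ ≤ u x) := by
  refine ⟨fun h ⟨x₀, hx₀, hmax⟩ => hu_nonconst ⟨u x₀, ?_⟩,
    fun h ⟨x₀, hx₀, hmin⟩ => hu_nonconst ⟨u x₀, fun x hx => ?_⟩⟩
  · exact h.eq_of_isMax hd hΩ_bdd hΩ_conn hMPI hu_cont hx₀ hmax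
  · exact neg_injective (h.neg.eq_of_isMax hd hΩ_bdd hΩ_conn hMPI hu_cont.neg hx₀
      (fun y hy => neg_le_neg (hmin y hy)) x hx)
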